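/- **Theorem (equivalence of the $J$- and $K$-methods with variable exponent).** Let $A_0,A_1$ be Banach spaces over $\mathbb K=\mathbb R$ or $\mathbb C$ forming a compatible couple, i.e. both are continuously embedded in a Hausdorff topological vector space $Z$. The sum $A_0+A_1\subseteq Z$ is normed by $\|f\|_{A_0+A_1}=\inf_{f=f_0+f_1}(\|f_0\|_{A_0}+\|f_1\|_{A_1})$ and the intersection $A_0\cap A_1$ by $\max(\|f\|_{A_0},\|f\|_{A_1})$. For $t>0$ put $$K(t,f)=\inf_{f=f_0+f_1,\ f_i\in A_i}\big(\|f_0\|_{A_0}+t\|f_1\|_{A_1}\big)\quad (f\in A_0+A_1),\qquad J(t,f)=\max\big(\|f\|_{A_0},t\|f\|_{A_1}\big)\quad (f\in A_0\cap A_1).$$ Let $\theta\in(0,1)$ and let $q:\mathbb R\to[1,\infty)$ be measurable and log-Hölder continuous at the origin and at infinity, i.e. there are $q_\infty\in\mathbb R$ and $c>0$ with $$|q(x)-q(0)|\le \frac{c}{\log(e+1/|x|)}\ \ (x\neq 0),\qquad |q(x)-q_\infty|\le\frac{c}{\log(e+|x|)}\ \ (x\in\mathbb R).$$ For measurable $g$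 on $(0,\infty)$ let $$\|g\|_{L^{q(\cdot)}((0,\infty),\frac{dt}{t})}=\inf\Big\{\lambda>0:\int_0^\infty\Big(\frac{|g(t)|}{\lambda}\Big)^{q(t)}\frac{dt}{t}\le 1\Big\}\in[0,\infty],\qquad \inf\emptyset=\infty .$$ The space $(A_0,A_1)_{\theta,q(\cdot)}$ consists of all $f\in A_0+A_1$ for which $$\|f\|_{(A_0,A_1)_{\theta,q(\cdot)}}=\big\|t^{-\theta}K(t,f)\big\|_{L^{q(\cdot)}((0,\infty),\frac{dt}{t})}<\infty .$$ The space $(A_0,A_1)_{\theta,q(\cdot),J}$ consists of all $f\in A_0+A_1$ for which $$\|f\|_{(A_0,A_1)_{\theta,q(\cdot),J}}=\inf_u\big\|t^{-\theta}J(t,u(t))\big\|_{L^{q(\cdot)}((0,\infty),\frac{dt}{t})}<\infty ,$$ where the infimum is over all strongly measurable $u:(0,\infty)\to A_0\cap A_1$ with $f=\int_0^\infty u(t)\,\frac{dt}{t}$ as a Bochner integral in $A_0+A_1$ (and is $\infty$ if there is no such $u$). Then $(A_0,A_1)_{\theta,q(\cdot),J}=(A_0,A_1)_{\theta,q(\cdot)}$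 as sets, and the norms are equivalent: there are constants $c_1,c_2>0$ such that $$c_1\|f\|_{(A_0,A_1)_{\theta,q(\cdot)}}\le\|f\|_{(A_0,A_1)_{\theta,q(\cdot),J}}\le c_2\|f\|_{(A_0,A_1)_{\theta,q(\cdot)}}\qquad\text{for all } f\in(A_0,A_1)_{\theta,q(\cdot)} .$$ -/

import Mathlib

open MeasureTheory Set Filter Topology
open scoped NNReal ENNReal

/-! ### Compatible couples of Banach spaces -/

/-- A compatible couple `(A₀, A₁)`: continuous linear embeddings of `A₀` and `A₁` into the
same topological vector space `Z` (which is assumed Hausdorff wherever it matters). -/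
structure CompatibleCouple (𝕜 A₀ A₁ Z : Type*) [RCLike 𝕜]
    [NormedAddCommGroup A₀] [NormedSpace 𝕜 A₀] [NormedAddCommGroup A₁] [NormedSpace 𝕜 A₁]
    [AddCommGroup Z] [Module 𝕜 Z] [TopologicalSpace Z] where
  incl₀ : A₀ →L[𝕜] Z
  incl₁ : A₁ →L[𝕜] Z
  injective₀ : Function.Injective incl₀
  injective₁ : Function.Injective incl₁

namespace CompatibleCouple

section

variable {𝕜 A₀ A₁ Z : Type*} [RCLike 𝕜]
  [NormedAddCommGroup A₀] [NormedSpace 𝕜 A₀] [NormedAddCommGroup A₁] [NormedSpace 𝕜 A₁]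
  [AddCommGroup Z] [Module 𝕜 Z] [TopologicalSpace Z]

/-- The sum `A₀ + A₁`, as a linear subspace of `Z`. -/
def sumSubmodule (C : CompatibleCouple 𝕜 A₀ A₁ Z) : Submodule 𝕜 Z :=
  LinearMap.range C.incl₀.toLinearMap ⊔ LinearMap.range C.incl₁.toLinearMap

/-- The vector space `A₀ + A₁ ⊆ Z`. It is a separate type because it carries its own norm,
and not the topology induced by `Z`. -/
def SumSpace (C : CompatibleCouple 𝕜 A₀ A₁ Z) : Type _ := C.sumSubmodule

/-- The element of `Z` underlying an element of `A₀ + A₁`. -/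
def SumSpace.val {C : CompatibleCouple 𝕜 A₀ A₁ Z} (f : C.SumSpace) : Z := Subtype.val f

noncomputable instance (C : CompatibleCouple 𝕜 A₀ A₁ Z) : AddCommGroup C.SumSpace :=
  inferInstanceAs (AddCommGroup C.sumSubmodule)

noncomputable instance (C : CompatibleCouple 𝕜 A₀ A₁ Z) : Module 𝕜 C.SumSpace :=
  inferInstanceAs (Module 𝕜 C.sumSubmodule)

/-- The pairs `(f₀, f₁)` in `A₀ × A₁` with `f = f₀ + f₁` in `Z`. -/
def Decomp (C : CompatibleCouple 𝕜 A₀ A₁ Z) (f : C.SumSpace) : Type _ :=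
  {p : A₀ × A₁ // C.incl₀ p.1 + C.incl₁ p.2 = f.val}

/-- The functional `K(t, f) = inf (‖f₀‖ + t ‖f₁‖)`, the infimum being taken over all
decompositions `f = f₀ + f₁`. -/
noncomputable def kFunctional (C : CompatibleCouple 𝕜 A₀ A₁ Z) (t : ℝ) (f : C.SumSpace) : ℝ :=
  ⨅ p : C.Decomp f, (‖p.1.1‖ + t * ‖p.1.2‖)

/-- The intersection `A₀ ∩ A₁`: an element is a pair `(a₀, a₁)` in `A₀ × A₁` whose two
components are the same element of `Z`. The norm inherited from `A₀ × A₁` is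
`max ‖a₀‖ ‖a₁‖`. -/
def interSpace (C : CompatibleCouple 𝕜 A₀ A₁ Z) : Submodule 𝕜 (A₀ × A₁) :=
  LinearMap.eqLocus (C.incl₀.toLinearMap ∘ₗ LinearMap.fst 𝕜 A₀ A₁)
    (C.incl₁.toLinearMap ∘ₗ LinearMap.snd 𝕜 A₀ A₁)

/-- The functional `J(t, f) = max (‖f‖_{A₀}, t ‖f‖_{A₁})` for `f` in `A₀ ∩ A₁`. -/
noncomputable def jFunctional (C : CompatibleCouple 𝕜 A₀ A₁ Z) (t : ℝ) (f : C.interSpace) : ℝ :=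
  max ‖f.1.1‖ (t * ‖f.1.2‖)

/-- The inclusion of `A₀ ∩ A₁` in `A₀ + A₁`. -/
def interToSum (C : CompatibleCouple 𝕜 A₀ A₁ Z) (f : C.interSpace) : C.SumSpace :=
  (⟨C.incl₀ f.1.1, Submodule.mem_sup_left ⟨f.1.1, rfl⟩⟩ : C.sumSubmodule)

/-! #### The norm of `A₀ + A₁` -/

lemma SumSpace.val_injective (C : CompatibleCouple 𝕜 A₀ A₁ Z) :
    Function.Injective (SumSpace.val (C := C)) := Subtype.val_injective

instance (C : CompatibleCouple 𝕜 A₀ A₁ Z) (f : C.SumSpace) : Nonempty (C.Decomp f) := by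
  obtain ⟨y, ⟨a, ha⟩, z, ⟨b, hb⟩, h⟩ := Submodule.mem_sup.1 (Subtype.prop f)
  exact ⟨⟨(a, b), by
    have h' : y + z = f.val := h
    rw [← h', ← ha, ← hb]; rfl⟩⟩

lemma kFunctional_le (C : CompatibleCouple 𝕜 A₀ A₁ Z) {t : ℝ} (ht : 0 ≤ t) {f : C.SumSpace}
    (p : C.Decomp f) : C.kFunctional t f ≤ ‖p.1.1‖ + t * ‖p.1.2‖ :=
  ciInf_le ⟨0, by rintro _ ⟨x, rfl⟩; positivity⟩ p

lemma exists_decomp_lt (C : CompatibleCouple 𝕜 A₀ A₁ Z) {t : ℝ} {f : C.SumSpace} {r : ℝ}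
    (h : C.kFunctional t f < r) : ∃ p : C.Decomp f, ‖p.1.1‖ + t * ‖p.1.2‖ < r :=
  exists_lt_of_ciInf_lt h

lemma kFunctional_nonneg (C : CompatibleCouple 𝕜 A₀ A₁ Z) {t : ℝ} (ht : 0 ≤ t)
    (f : C.SumSpace) : 0 ≤ C.kFunctional t f :=
  le_ciInf fun _ => by positivity

lemma kFunctional_add_le (C : CompatibleCouple 𝕜 A₀ A₁ Z) {t : ℝ} (ht : 0 ≤ t)
    (f g : C.SumSpace) : C.kFunctional t (f + g) ≤ C.kFunctional t f + C.kFunctional t g := by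
  refine le_of_forall_pos_le_add fun ε hε => ?_
  obtain ⟨⟨p, hp⟩, hp'⟩ := C.exists_decomp_lt (lt_add_of_pos_right (C.kFunctional t f) (half_pos hε))
  obtain ⟨⟨r, hr⟩, hr'⟩ := C.exists_decomp_lt (lt_add_of_pos_right (C.kFunctional t g) (half_pos hε))
  have hfg : C.incl₀ (p + r).1 + C.incl₁ (p + r).2 = (f + g).val := by
    have : (f + g).val = f.val + g.val := rfl
    rw [this, ← hp, ← hr, Prod.fst_add, Prod.snd_add, map_add, map_add]
    abel
  have h := C.kFunctional_le ht (f := f + g) ⟨p + r, hfg⟩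
  have h1 := norm_add_le p.1 r.1
  have h2 := mul_le_mul_of_nonneg_left (norm_add_le p.2 r.2) ht
  simp only [Prod.fst_add, Prod.snd_add] at h hp' hr'
  linarith

lemma kFunctional_smul_le (C : CompatibleCouple 𝕜 A₀ A₁ Z) {t : ℝ} (ht : 0 ≤ t) (c : 𝕜)
    (f : C.SumSpace) : C.kFunctional t (c • f) ≤ ‖c‖ * C.kFunctional t f := by
  rw [kFunctional.eq_def C t f, Real.mul_iInf_of_nonneg (norm_nonneg c)]
  refine le_ciInf fun ⟨p, hp⟩ => ?_
  have hc : C.incl₀ (c • p).1 + C.incl₁ (c • p).2 = (c • f).val := by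
    have : (c • f).val = c • f.val := rfl
    rw [this, ← hp, Prod.smul_fst, Prod.smul_snd, map_smul, map_smul, smul_add]
  refine (C.kFunctional_le ht (f := c • f) ⟨c • p, hc⟩).trans (le_of_eq ?_)
  simp only [Prod.smul_fst, Prod.smul_snd, norm_smul]
  ring

lemma eq_zero_of_kFunctional [ContinuousAdd Z] [T2Space Z] (C : CompatibleCouple 𝕜 A₀ A₁ Z)
    (f : C.SumSpace) (h : C.kFunctional 1 f = 0) : f = 0 := by
  have key : ∀ n : ℕ, ∃ p : C.Decomp f, ‖p.1.1‖ + 1 * ‖p.1.2‖ < 1 / ((n : ℝ) + 1) := fun n =>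
    C.exists_decomp_lt (by rw [h]; positivity)
  choose p hp using key
  have l0 : Tendsto (fun n => (p n).1.1) atTop (𝓝 0) :=
    squeeze_zero_norm (fun n => by have := hp n; have := norm_nonneg (p n).1.2; linarith)
      tendsto_one_div_add_atTop_nhds_zero_nat
  have l1 : Tendsto (fun n => (p n).1.2) atTop (𝓝 0) :=
    squeeze_zero_norm (fun n => by have := hp n; have := norm_nonneg (p n).1.1; linarith)
      tendsto_one_div_add_atTop_nhds_zero_nat
  have l := ((C.incl₀.continuous.tendsto 0).comp l0).add ((C.incl₁.continuous.tendsto 0).comp l1)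
  have e : (fun n => (C.incl₀ ∘ fun n => (p n).1.1) n + (C.incl₁ ∘ fun n => (p n).1.2) n)
      = fun _ => f.val := funext fun n => (p n).2
  rw [e, map_zero, map_zero, add_zero] at l
  exact SumSpace.val_injective C (tendsto_nhds_unique tendsto_const_nhds l)

/-- The norm of `A₀ + A₁`: `‖f‖ = K(1, f) = inf (‖f₀‖ + ‖f₁‖)` over all `f = f₀ + f₁`. -/
noncomputable instance [ContinuousAdd Z] [T2Space Z] (C : CompatibleCouple 𝕜 A₀ A₁ Z) :
    NormedAddCommGroup C.SumSpace :=
  AddGroupNorm.toNormedAddCommGroup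
    { toFun := C.kFunctional 1
      map_zero' := le_antisymm
        (by simpa using C.kFunctional_smul_le zero_le_one (0 : 𝕜) (0 : C.SumSpace))
        (C.kFunctional_nonneg zero_le_one _)
      add_le' := C.kFunctional_add_le zero_le_one
      neg' := fun f => le_antisymm
        (by simpa using C.kFunctional_smul_le zero_le_one (-1 : 𝕜) f)
        (by simpa using C.kFunctional_smul_le zero_le_one (-1 : 𝕜) (-f))
      eq_zero_of_map_eq_zero' := C.eq_zero_of_kFunctional }

lemma SumSpace.norm_def [ContinuousAdd Z] [T2Space Z] (C : CompatibleCouple 𝕜 A₀ A₁ Z)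
    (f : C.SumSpace) : ‖f‖ = C.kFunctional 1 f := rfl

noncomputable instance [ContinuousAdd Z] [T2Space Z] (C : CompatibleCouple 𝕜 A₀ A₁ Z) :
    NormedSpace 𝕜 C.SumSpace where
  norm_smul_le c f := C.kFunctional_smul_le zero_le_one c f

/-- The real normed space underlying `A₀ + A₁`, over which vector-valued integrals are
formed. -/
noncomputable instance [ContinuousAdd Z] [T2Space Z] (C : CompatibleCouple 𝕜 A₀ A₁ Z) :
    NormedSpace ℝ C.SumSpace :=
  NormedSpace.restrictScalars ℝ 𝕜 C.SumSpace

/-- `A₀ + A₁` is a Banach space, so that Bochner integrals in it have their usual meaning. -/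
instance [CompleteSpace A₀] [CompleteSpace A₁] [ContinuousAdd Z] [T2Space Z]
    (C : CompatibleCouple 𝕜 A₀ A₁ Z) : CompleteSpace C.SumSpace := by
  refine NormedAddCommGroup.completeSpace_of_summable_imp_tendsto fun u hu => ?_
  have key : ∀ n : ℕ, ∃ p : C.Decomp (u n), ‖p.1.1‖ + 1 * ‖p.1.2‖ < ‖u n‖ + (1 / 2 : ℝ) ^ n :=
    fun n => C.exists_decomp_lt (lt_add_of_pos_right _ (by positivity))
  choose p hp using key
  have hs : Summable fun n => ‖u n‖ + (1 / 2 : ℝ) ^ n := hu.add summable_geometric_two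
  have s0 : Summable fun n => (p n).1.1 := Summable.of_norm_bounded hs fun n => by
    have := hp n; have := norm_nonneg (p n).1.2; linarith
  have s1 : Summable fun n => (p n).1.2 := Summable.of_norm_bounded hs fun n => by
    have := hp n; have := norm_nonneg (p n).1.1; linarith
  obtain ⟨a, ha⟩ := s0
  obtain ⟨b, hb⟩ := s1
  let F : C.SumSpace := (⟨C.incl₀ a + C.incl₁ b, Submodule.add_mem _
    (Submodule.mem_sup_left ⟨a, rfl⟩) (Submodule.mem_sup_right ⟨b, rfl⟩)⟩ : C.sumSubmodule)
  refine ⟨F, tendsto_iff_norm_sub_tendsto_zero.2 ?_⟩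
  have la := tendsto_iff_norm_sub_tendsto_zero.1 ha.tendsto_sum_nat
  have lb := tendsto_iff_norm_sub_tendsto_zero.1 hb.tendsto_sum_nat
  have lab := la.add lb
  rw [add_zero] at lab
  refine squeeze_zero (fun n => norm_nonneg _) (fun n => ?_) lab
  have hd : C.incl₀ (∑ i ∈ Finset.range n, (p i).1.1 - a)
      + C.incl₁ (∑ i ∈ Finset.range n, (p i).1.2 - b)
      = (∑ i ∈ Finset.range n, u i - F).val := by
    have e1 : (∑ i ∈ Finset.range n, u i - F).val
        = (∑ i ∈ Finset.range n, (u i).val) - (C.incl₀ a + C.incl₁ b) := by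
      have h2 : (∑ i ∈ Finset.range n, u i).val = ∑ i ∈ Finset.range n, (u i).val :=
        map_sum C.sumSubmodule.subtype u (Finset.range n)
      rw [← h2]; rfl
    rw [e1, map_sub, map_sub, map_sum, map_sum,
      ← Finset.sum_congr rfl fun i _ => (p i).2, Finset.sum_add_distrib]
    abel
  have h := C.kFunctional_le zero_le_one (f := ∑ i ∈ Finset.range n, u i - F) ⟨(_, _), hd⟩
  rw [one_mul] at h
  exact h

end

end CompatibleCouple

/-! ### Variable exponents and variable exponent Lebesgue norms -/

/-- The class of variable exponents on `ℝ`: Lebesgue measurable functions with values in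
`[1, ∞)`. -/
def IsVariableExponent (q : ℝ → ℝ) : Prop :=
  AEMeasurable q volume ∧ ∀ x, 1 ≤ q x

/-- Log-Hölder continuity at the origin. (At `x = 0` the inequality is trivial.) -/
def LogHolderAtOrigin (q : ℝ → ℝ) : Prop :=
  ∃ c : ℝ, 0 < c ∧ ∀ x : ℝ, |q x - q 0| ≤ c / Real.log (Real.exp 1 + 1 / |x|)

/-- Log-Hölder continuity at infinity (the log-Hölder decay condition). -/
def LogHolderAtInfinity (q : ℝ → ℝ) : Prop :=
  ∃ qInf : ℝ, ∃ c : ℝ, 0 < c ∧ ∀ x : ℝ, |q x - qInf| ≤ c / Real.log (Real.exp 1 + |x|)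

/-- The measure `dt / t` on `(0, ∞)`, as a measure on `ℝ`. -/
noncomputable def multMeasure : Measure ℝ :=
  (volume.restrict (Ioi (0 : ℝ))).withDensity fun t => ENNReal.ofReal t⁻¹

/-- The modular `∫ |g(t)| ^ q(t) dt / t` over `(0, ∞)`. -/
noncomputable def varModular (q g : ℝ → ℝ) : ℝ≥0∞ :=
  ∫⁻ t, ENNReal.ofReal (|g t| ^ q t) ∂multMeasure

/-- The Luxemburg norm of `L^{q(·)}((0, ∞), dt / t)`, equal to `∞` for functions that are not
in this space. -/
noncomputable def varNorm (q g : ℝ → ℝ) : ℝ≥0∞ :=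
  ⨅ (r : ℝ) (_ : 0 < r) (_ : varModular q (fun t => g t / r) ≤ 1), ENNReal.ofReal r

/-! ### The `K`-method and the `J`-method with a variable exponent -/

namespace CompatibleCouple

section

variable {𝕜 A₀ A₁ Z : Type*} [RCLike 𝕜]
  [NormedAddCommGroup A₀] [NormedSpace 𝕜 A₀] [NormedAddCommGroup A₁] [NormedSpace 𝕜 A₁]
  [AddCommGroup Z] [Module 𝕜 Z] [TopologicalSpace Z]

/-- The norm `‖t ^ (-θ) K(t, f)‖` in `L^{q(·)}((0, ∞), dt / t)`. -/
noncomputable def kNorm (C : CompatibleCouple 𝕜 A₀ A₁ Z) (θ : ℝ) (q : ℝ → ℝ)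
    (f : C.SumSpace) : ℝ≥0∞ :=
  varNorm q fun t => t ^ (-θ) * C.kFunctional t f

/-- The space `(A₀, A₁)_{θ,q(·)}` of the `K`-method. -/
def kSpace (C : CompatibleCouple 𝕜 A₀ A₁ Z) (θ : ℝ) (q : ℝ → ℝ) : Set C.SumSpace :=
  {f | C.kNorm θ q f < ∞}

/-- `f = ∫₀^∞ u(t) dt / t`, where `u` is strongly measurable on `(0, ∞)` with values in
`A₀ ∩ A₁` and the integral is a Bochner integral in `A₀ + A₁`. -/
def IsIntegralRep [ContinuousAdd Z] [T2Space Z] (C : CompatibleCouple 𝕜 A₀ A₁ Z)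
    (u : ℝ → C.interSpace) (f : C.SumSpace) : Prop :=
  AEStronglyMeasurable u multMeasure ∧
    Integrable (fun t => C.interToSum (u t)) multMeasure ∧
    ∫ t, C.interToSum (u t) ∂multMeasure = f

/-- The infimum of the norms of `t ^ (-θ) J(t, u(t))` in `L^{q(·)}((0, ∞), dt / t)` over all
representations `f = ∫₀^∞ u(t) dt / t`. -/
noncomputable def jNorm [ContinuousAdd Z] [T2Space Z] (C : CompatibleCouple 𝕜 A₀ A₁ Z) (θ : ℝ)
    (q : ℝ → ℝ) (f : C.SumSpace) : ℝ≥0∞ :=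
  ⨅ (u : ℝ → C.interSpace) (_ : C.IsIntegralRep u f),
    varNorm q fun t => t ^ (-θ) * C.jFunctional t (u t)

/-- The space `(A₀, A₁)_{θ,q(·),J}` of the `J`-method. -/
def jSpace [ContinuousAdd Z] [T2Space Z] (C : CompatibleCouple 𝕜 A₀ A₁ Z) (θ : ℝ)
    (q : ℝ → ℝ) : Set C.SumSpace :=
  {f | C.jNorm θ q f < ∞}

end

end CompatibleCouple

/-!
Everything is transported to the real line by `t = exp x`, which turns `dt / t` into Lebesgue
measure (`multMeasure_eq_map_exp`) and log-Hölder continuity of `q` at `0` and `∞` into the bound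
`|q (exp x) - q (exp y)| ≤ c / min |x| |y|` for `x` and `y` of the same sign
(`exists_abs_sub_mul_min_le`). Since `q ≥ 1`, a bound for the modular on the unit ball is a bound
for the Luxemburg norm (`varModular_div_le_one`).

*The `K`-norm is bounded by the `J`-norm.* Let `f = ∫ u(s) ds / s`. Integrating `u` over `(0, t)` in
`A₀` and over `[t, ∞)` in `A₁` decomposes `f`, so that `K(t, f) ≤ ∫ min(1, t / s) J(s, u(s)) ds / s`
(`CompatibleCouple.ofReal_kFunctional_le_lintegral`). In logarithmic coordinates and with the
weights `t ^ (-θ)`, the right-hand side is dominated by the convolution of `s ^ (-θ) J(s, u(s))` with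
`exp (-δ |x|)`, where `δ = min θ (1 - θ)`. This convolution is bounded on the variable exponent
space (`exists_lintegral_conv_expKernel_rpow_le`). The only place where the exponent has to be
compared at different points is `a ^ p(x)` with `0 ≤ a ≤ 1`, and there it may be replaced by
`exp c * a ^ p(y)` with an integrable error (`expKernel_sub_mul_rpow_le`).

*The `J`-norm is bounded by the `K`-norm.* If the `K`-norm of `f` is finite, then the numbers
`min(1, exp (-n)) K(exp n, f)`, `n ∈ ℤ`, are summable
(`CompatibleCouple.summable_min_one_mul_kFunctional`). Differences of nearly optimal decompositions
of `f` at `exp (n + 1)` and `exp n` therefore form an absolutely convergent telescoping series with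
sum `f` (`CompatibleCouple.exists_hasSum_interToSum`), and the step function with these values on
`[exp n, exp (n + 1))` represents `f`. Its `J`-functional is at most `24 K(t, f)` pointwise
(`CompatibleCouple.jNorm_le_mul_kNorm`).
-/

/-! ### The measure `dt / t` in logarithmic coordinates -/

theorem multMeasure_eq_map_exp : multMeasure = Measure.map Real.exp volume := by
  ext s hs
  rw [multMeasure, withDensity_apply _ hs, Measure.map_apply Real.measurable_exp hs,
    Measure.restrict_restrict hs]
  have himg : s ∩ Ioi 0 = Real.exp '' (Real.exp ⁻¹' s) := by
    rw [image_preimage_eq_inter_range, Real.range_exp]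
  rw [himg, lintegral_image_eq_lintegral_abs_deriv_mul (hs.preimage Real.measurable_exp)
    (fun x _ => (Real.hasDerivAt_exp x).hasDerivWithinAt) Real.exp_injective.injOn]
  have h1 : ∀ x : ℝ, ENNReal.ofReal |Real.exp x| * ENNReal.ofReal (Real.exp x)⁻¹ = 1 := fun x => by
    rw [← ENNReal.ofReal_mul (abs_nonneg _), abs_of_pos (Real.exp_pos x),
      mul_inv_cancel₀ (Real.exp_pos x).ne', ENNReal.ofReal_one]
  simp only [h1, lintegral_const, one_mul, Measure.restrict_apply_univ]

theorem measurableEmbedding_real_exp : MeasurableEmbedding Real.exp :=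
  Real.continuous_exp.measurableEmbedding Real.exp_injective

theorem lintegral_multMeasure (g : ℝ → ℝ≥0∞) :
    ∫⁻ t, g t ∂multMeasure = ∫⁻ x, g (Real.exp x) := by
  rw [multMeasure_eq_map_exp, measurableEmbedding_real_exp.lintegral_map]

theorem aemeasurable_multMeasure_iff {β : Type*} [MeasurableSpace β] {g : ℝ → β} :
    AEMeasurable g multMeasure ↔ AEMeasurable (fun x => g (Real.exp x)) := by
  rw [multMeasure_eq_map_exp, measurableEmbedding_real_exp.aemeasurable_map_iff]
  rfl

theorem varModular_eq_lintegral_exp {q : ℝ → ℝ} (hq : ∀ x, 1 ≤ q x) (g : ℝ → ℝ) :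
    varModular q g = ∫⁻ x, ENNReal.ofReal |g (Real.exp x)| ^ q (Real.exp x) := by
  rw [varModular, lintegral_multMeasure]
  refine lintegral_congr fun x => ?_
  rw [ENNReal.ofReal_rpow_of_nonneg (abs_nonneg _) (zero_le_one.trans (hq _))]

theorem map_floor_volume : Measure.map (Int.floor : ℝ → ℤ) volume = Measure.count := by
  refine Measure.ext_of_singleton fun n => ?_
  rw [Measure.map_apply Int.measurable_floor (measurableSet_singleton n),
    Int.preimage_floor_singleton]
  simp

/-! ### Convolution with an exponential kernel -/

/-- The two-sided exponential kernel `exp (-δ |x|)`. In the variable `t = exp x` it is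
`min t t⁻¹ ^ δ`. -/
noncomputable def expKernel (δ x : ℝ) : ℝ≥0∞ := ENNReal.ofReal (Real.exp (-(δ * |x|)))

theorem measurable_expKernel (δ : ℝ) : Measurable (expKernel δ) := by
  unfold expKernel
  fun_prop

theorem expKernel_le_one {δ : ℝ} (hδ : 0 ≤ δ) (x : ℝ) : expKernel δ x ≤ 1 := by
  rw [expKernel, ENNReal.ofReal_le_one, Real.exp_le_one_iff, neg_nonpos]
  positivity

theorem lintegral_expKernel_ne_top {δ : ℝ} (hδ : 0 < δ) : ∫⁻ x, expKernel δ x ≠ ∞ := by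
  have h1 : ∫⁻ x in Ioi (0 : ℝ), expKernel δ x < ∞ := by
    rw [setLIntegral_congr_fun (g := fun x => ENNReal.ofReal (Real.exp (-δ * x)))
      measurableSet_Ioi fun x hx => by simp [expKernel, abs_of_pos (mem_Ioi.1 hx)]]
    exact (exp_neg_integrableOn_Ioi 0 hδ).lintegral_lt_top
  have h2 : ∫⁻ x in Iic (0 : ℝ), expKernel δ x < ∞ := by
    rw [setLIntegral_congr_fun (g := fun x => ENNReal.ofReal (Real.exp (δ * x)))
      measurableSet_Iic fun x hx => by simp [expKernel, abs_of_nonpos (mem_Iic.1 hx)]]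
    exact (integrableOn_exp_mul_Iic hδ 0).lintegral_lt_top
  rw [← lintegral_add_compl _ (measurableSet_Ioi (a := (0 : ℝ))), compl_Ioi]
  exact (ENNReal.add_lt_top.2 ⟨h1, h2⟩).ne

theorem lintegral_lintegral_expKernel_mul (δ : ℝ) {F : ℝ → ℝ≥0∞} (hF : AEMeasurable F) :
    ∫⁻ x, ∫⁻ y, expKernel δ (x - y) * F y = (∫⁻ x, expKernel δ x) * ∫⁻ y, F y := by
  rw [lintegral_lintegral_swap]
  · rw [← lintegral_const_mul'' _ hF]
    refine lintegral_congr fun y => ?_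
    have m : Measurable fun x => expKernel δ (x - y) :=
      (measurable_expKernel δ).comp (measurable_id.sub_const y)
    rw [lintegral_mul_const _ m,
      lintegral_sub_right_eq_self]
  · exact ((measurable_expKernel δ).comp (measurable_fst.sub measurable_snd)).aemeasurable.mul
      hF.comp_snd

/-- Jensen's inequality for the convex function `a ↦ a ^ p` and the (unnormalised) weight `w`. -/
theorem rpow_lintegral_mul_le {α : Type*} [MeasurableSpace α] {μ : Measure α} {w h : α → ℝ≥0∞}
    (hw : AEMeasurable w μ) (hh : AEMeasurable h μ) {p : ℝ} (hp : 1 ≤ p) :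
    (∫⁻ y, w y * h y ∂μ) ^ p ≤ (∫⁻ y, w y ∂μ) ^ (p - 1) * ∫⁻ y, w y * h y ^ p ∂μ := by
  have hp0 : 0 < p := zero_lt_one.trans_le hp
  have hi : 0 ≤ 1 - 1 / p := sub_nonneg.2 ((div_le_one hp0).2 hp)
  have H := ENNReal.lintegral_mul_norm_pow_le hw (hw.mul (hh.pow_const p)) hi
    (one_div_nonneg.2 hp0.le) (sub_add_cancel _ _)
  have e : ∀ y, w y ^ (1 - 1 / p) * (w y * h y ^ p) ^ (1 / p) = w y * h y := fun y => by
    rw [ENNReal.mul_rpow_of_nonneg _ _ (one_div_nonneg.2 hp0.le), ← mul_assoc,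
      ← ENNReal.rpow_add_of_nonneg _ _ hi (one_div_nonneg.2 hp0.le), sub_add_cancel,
      ENNReal.rpow_one, ← ENNReal.rpow_mul, mul_one_div_cancel hp0.ne', ENNReal.rpow_one]
  simp only [Pi.mul_apply, e] at H
  refine (ENNReal.rpow_le_rpow H hp0.le).trans (le_of_eq ?_)
  rw [ENNReal.mul_rpow_of_nonneg _ _ hp0.le, ← ENNReal.rpow_mul, ← ENNReal.rpow_mul,
    one_div_mul_cancel hp0.ne', ENNReal.rpow_one, sub_mul, one_div_mul_cancel hp0.ne', one_mul]

/-- Two exponents whose distance is at most `c / m` may be exchanged, at the price of an error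
`exp (-m)`: if `a ≥ exp (-m)`, then `a ^ (p - p')` is at most `exp c`, and if `a < exp (-m)`,
then `a ^ p ≤ a` is absorbed by the error. -/
theorem rpow_le_exp_mul_rpow_add {a : ℝ≥0∞} (ha : a ≤ 1) {p p' m c : ℝ} (hp : 1 ≤ p)
    (hp' : 1 ≤ p') (hc : |p - p'| * m ≤ c) :
    a ^ p ≤ ENNReal.ofReal (Real.exp c) * a ^ p' + ENNReal.ofReal (Real.exp (-m)) := by
  lift a to ℝ≥0 using ne_top_of_le_ne_top ENNReal.one_ne_top ha
  obtain ⟨r, hr, rfl⟩ : ∃ r : ℝ, 0 ≤ r ∧ a = r.toNNReal := ⟨a, a.2, by simp⟩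
  change ENNReal.ofReal r ≤ 1 at ha
  change ENNReal.ofReal r ^ p ≤ _ * ENNReal.ofReal r ^ p' + _
  rw [ENNReal.ofReal_le_one] at ha
  rw [ENNReal.ofReal_rpow_of_nonneg hr (by linarith),
    ENNReal.ofReal_rpow_of_nonneg hr (by linarith),
    ← ENNReal.ofReal_mul (Real.exp_pos c).le,
    ← ENNReal.ofReal_add (by positivity) (Real.exp_pos _).le]
  refine ENNReal.ofReal_le_ofReal ?_
  rcases le_or_gt r (Real.exp (-m)) with h | h
  · have h1 : r ^ p ≤ r ^ (1 : ℝ) := Real.rpow_le_rpow_of_exponent_ge' hr ha zero_le_one hp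
    rw [Real.rpow_one] at h1
    have : 0 ≤ Real.exp c * r ^ p' := by positivity
    linarith
  · have hr0 : 0 < r := (Real.exp_pos _).trans h
    have hl : -m < Real.log r := (Real.lt_log_iff_exp_lt hr0).2 h
    have hl0 : Real.log r ≤ 0 := Real.log_nonpos hr ha
    have h1 : (p - p') * Real.log r ≤ c := calc
      (p - p') * Real.log r ≤ |(p - p') * Real.log r| := le_abs_self _
      _ = |p - p'| * -Real.log r := by rw [abs_mul, abs_of_nonpos hl0]
      _ ≤ |p - p'| * m := mul_le_mul_of_nonneg_left (by linarith) (abs_nonneg _)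
      _ ≤ c := hc
    have h2 : r ^ p ≤ Real.exp c * r ^ p' := by
      rw [Real.rpow_def_of_pos hr0, Real.rpow_def_of_pos hr0, ← Real.exp_add, Real.exp_le_exp]
      linarith
    have := Real.exp_pos (-m)
    linarith

/-- The exponent `p x` may be replaced by `p y` under the kernel `expKernel δ (x - y)`, up to
errors that are integrable in `x` and `y`. If `x` and `y` have the same sign, this is the decay of
the oscillation of `p`; if not, the kernel splits into a product. -/
theorem expKernel_sub_mul_rpow_le {δ : ℝ} (hδ1 : δ ≤ 1) {p : ℝ → ℝ}
    (hp1 : ∀ x, 1 ≤ p x) {c : ℝ}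
    (hc : ∀ x y, 0 ≤ x * y → |p x - p y| * min |x| |y| ≤ c) {a : ℝ≥0∞} (ha : a ≤ 1) (x y : ℝ) :
    expKernel δ (x - y) * a ^ p x ≤
      expKernel δ (x - y) * (ENNReal.ofReal (Real.exp c) * a ^ p y + expKernel δ y) +
        (expKernel δ (x - y) * expKernel δ x + expKernel δ x * expKernel δ y) := by
  rcases le_or_gt 0 (x * y) with h | h
  · have hm : ENNReal.ofReal (Real.exp (-min |x| |y|)) ≤ expKernel δ y + expKernel δ x := by
      have h1 : ∀ z : ℝ, ENNReal.ofReal (Real.exp (-|z|)) ≤ expKernel δ z := fun z =>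
        ENNReal.ofReal_le_ofReal (Real.exp_le_exp.2 (by nlinarith [abs_nonneg z]))
      rcases min_choice |x| |y| with e | e <;> rw [e]
      · exact (h1 x).trans le_add_self
      · exact (h1 y).trans le_self_add
    calc expKernel δ (x - y) * a ^ p x
        ≤ expKernel δ (x - y) * (ENNReal.ofReal (Real.exp c) * a ^ p y
          + (expKernel δ y + expKernel δ x)) :=
          mul_le_mul_right ((rpow_le_exp_mul_rpow_add ha (hp1 x) (hp1 y) (hc x y h)).trans
            (add_le_add_right hm _)) _
      _ = expKernel δ (x - y) * (ENNReal.ofReal (Real.exp c) * a ^ p y + expKernel δ y) +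
          expKernel δ (x - y) * expKernel δ x := by ring
      _ ≤ _ := add_le_add_right le_self_add _
  · have e : expKernel δ (x - y) = expKernel δ x * expKernel δ y := by
      have : |x - y| = |x| + |y| := by
        rcases mul_neg_iff.1 h with ⟨hx, hy⟩ | ⟨hx, hy⟩
        · rw [abs_of_pos hx, abs_of_neg hy, abs_of_pos (by linarith)]; ring
        · rw [abs_of_neg hx, abs_of_pos hy, abs_of_neg (by linarith)]; ring
      rw [expKernel, expKernel, expKernel, ← ENNReal.ofReal_mul (Real.exp_pos _).le, ← Real.exp_add,
        this]
      congr 2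
      ring
    calc expKernel δ (x - y) * a ^ p x ≤ expKernel δ (x - y) * 1 :=
          mul_le_mul_right (ENNReal.rpow_le_one ha (zero_le_one.trans (hp1 x))) _
      _ = expKernel δ x * expKernel δ y := by rw [mul_one, e]
      _ ≤ _ := le_add_self.trans le_add_self

/-- Convolution with an exponential kernel is bounded on `L^{p(·)}(ℝ)` in the modular sense, if the
oscillation of the bounded exponent `p` decays on each half-line; no local regularity of `p` is
needed. Write `h = h₁ + h₂` with `h₁ = h 1_{h ≤ 1}`. The convolution with `h₁` is estimated by
Jensen's inequality with the exponent `p x`, which `expKernel_sub_mul_rpow_le` exchanges for `p y`.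
As `h₂ ≤ h ^ p`, the convolution with `h₂` is integrable and at most `1`. -/
theorem exists_lintegral_conv_expKernel_rpow_le {δ : ℝ} (hδ : 0 < δ) (hδ1 : δ ≤ 1) {p : ℝ → ℝ}
    (hpm : AEMeasurable p) (hp1 : ∀ x, 1 ≤ p x) {Q : ℝ} (hQ : ∀ x, p x ≤ Q) {c : ℝ}
    (hc : ∀ x y, 0 ≤ x * y → |p x - p y| * min |x| |y| ≤ c) :
    ∃ M : ℝ≥0, ∀ h : ℝ → ℝ≥0∞, AEMeasurable h → ∫⁻ y, h y ^ p y ≤ 1 →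
      ∫⁻ x, (∫⁻ y, expKernel δ (x - y) * h y) ^ p x ≤ M := by
  set W := ∫⁻ x, expKernel δ x with hW
  have hWtop : W ≠ ∞ := lintegral_expKernel_ne_top hδ
  set B := ENNReal.ofReal (Real.exp c) with hB
  set D : ℝ≥0∞ := 2 ^ Q * (1 + W) ^ Q with hD
  have hQ0 : 0 ≤ Q := zero_le_one.trans ((hp1 0).trans (hQ 0))
  have hDtop : D ≠ ∞ := ENNReal.mul_ne_top (ENNReal.rpow_ne_top_of_nonneg hQ0 (by simp))
    (ENNReal.rpow_ne_top_of_nonneg hQ0 (by simp [hWtop]))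
  have hMtop : D * (W * (B + W + 1) + 2 * W * W) ≠ ∞ := by
    refine ENNReal.mul_ne_top hDtop (ENNReal.add_ne_top.2 ⟨ENNReal.mul_ne_top hWtop ?_, ?_⟩)
    · simp [hB, hWtop]
    · exact ENNReal.mul_ne_top (ENNReal.mul_ne_top (by simp) hWtop) hWtop
  refine ⟨(D * (W * (B + W + 1) + 2 * W * W)).toNNReal, fun h hh hmod => ?_⟩
  rw [ENNReal.coe_toNNReal hMtop]
  have hkm : ∀ x, Measurable fun y => expKernel δ (x - y) := fun x =>
    (measurable_expKernel δ).comp (measurable_id.const_sub x)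
  have hkW : ∀ x, ∫⁻ y, expKernel δ (x - y) = W := fun x =>
    lintegral_sub_left_eq_self (μ := volume) (expKernel δ) x
  have hhp : AEMeasurable fun y => h y ^ p y := hh.pow hpm
  set h₁ : ℝ → ℝ≥0∞ := fun y => if h y ≤ 1 then h y else 0 with hh₁
  set h₂ : ℝ → ℝ≥0∞ := fun y => if h y ≤ 1 then 0 else h y with hh₂
  have hle : MeasurableSet {a : ℝ≥0∞ | a ≤ 1} := measurableSet_Iic
  have m₁ : AEMeasurable h₁ :=
    (Measurable.ite hle measurable_id measurable_const).comp_aemeasurable hh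
  have m₂ : AEMeasurable h₂ :=
    (Measurable.ite hle measurable_const measurable_id).comp_aemeasurable hh
  have hsum : ∀ y, h y = h₁ y + h₂ y := fun y => by
    by_cases hy : h y ≤ 1 <;> simp [hh₁, hh₂, hy]
  have h₁le : ∀ y, h₁ y ≤ 1 := fun y => by
    by_cases hy : h y ≤ 1 <;> simp [hh₁, hy]
  have h₁p : ∀ y, h₁ y ^ p y ≤ h y ^ p y := fun y =>
    ENNReal.rpow_le_rpow (by rw [hsum y]; exact le_self_add) (zero_le_one.trans (hp1 y))
  have h₂p : ∀ y, h₂ y ≤ h y ^ p y := fun y => by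
    by_cases hy : h y ≤ 1
    · simp [hh₂, hy]
    · simp only [hh₂, hy, if_false]
      simpa using ENNReal.rpow_le_rpow_of_exponent_le (not_le.1 hy).le (hp1 y)
  set F : ℝ → ℝ≥0∞ := fun y => (B * h y ^ p y + expKernel δ y) + h y ^ p y with hF
  have mF : AEMeasurable F := ((hhp.const_mul B).add (measurable_expKernel δ).aemeasurable).add hhp
  have key : ∀ x, (∫⁻ y, expKernel δ (x - y) * h y) ^ p x ≤
      D * ((∫⁻ y, expKernel δ (x - y) * F y) + 2 * W * expKernel δ x) := by
    intro x
    have e0 : ∫⁻ y, expKernel δ (x - y) * h y =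
        (∫⁻ y, expKernel δ (x - y) * h₁ y) + ∫⁻ y, expKernel δ (x - y) * h₂ y := by
      have m : AEMeasurable fun y => expKernel δ (x - y) * h₁ y := (hkm x).aemeasurable.mul m₁
      rw [← lintegral_add_left' m]
      exact lintegral_congr fun y => by rw [hsum y, mul_add]
    have e1 : (∫⁻ y, expKernel δ (x - y) * h₁ y) ^ p x ≤ (1 + W) ^ Q *
        ((∫⁻ y, expKernel δ (x - y) * (B * h y ^ p y + expKernel δ y)) +
          2 * W * expKernel δ x) := by
      refine (rpow_lintegral_mul_le (hkm x).aemeasurable m₁ (hp1 x)).trans (mul_le_mul' ?_ ?_)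
      · rw [hkW]
        exact (ENNReal.rpow_le_rpow le_add_self (by linarith [hp1 x])).trans
          (ENNReal.rpow_le_rpow_of_exponent_le le_self_add (by linarith [hQ x]))
      · calc ∫⁻ y, expKernel δ (x - y) * h₁ y ^ p x
            ≤ ∫⁻ y, (expKernel δ (x - y) * (B * h y ^ p y + expKernel δ y) +
              (expKernel δ (x - y) * expKernel δ x + expKernel δ x * expKernel δ y)) := by
              refine lintegral_mono fun y =>
                (expKernel_sub_mul_rpow_le hδ1 hp1 hc (h₁le y) x y).trans ?_
              exact add_le_add_left (mul_le_mul_right (add_le_add_left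
                (mul_le_mul_right (h₁p y) _) _) _) _
          _ = _ := by
              have mc : Measurable fun y => expKernel δ (x - y) * expKernel δ x :=
                (hkm x).mul_const _
              have mc' : Measurable fun y => expKernel δ (x - y) * expKernel δ x +
                  expKernel δ x * expKernel δ y :=
                mc.add ((measurable_expKernel δ).const_mul _)
              rw [lintegral_add_right _ mc',
                lintegral_add_left mc, lintegral_mul_const _ (hkm x),
                lintegral_const_mul _ (measurable_expKernel δ), hkW, ← hW]
              ring
    have e2 : (∫⁻ y, expKernel δ (x - y) * h₂ y) ^ p x ≤
        ∫⁻ y, expKernel δ (x - y) * h y ^ p y := by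
      have a1 : ∫⁻ y, expKernel δ (x - y) * h₂ y ≤ 1 :=
        (lintegral_mono fun y => (mul_le_mul' (expKernel_le_one hδ.le _) (h₂p y)).trans_eq
          (one_mul _)).trans hmod
      refine (ENNReal.rpow_le_rpow_of_exponent_ge a1 (hp1 x)).trans ?_
      rw [ENNReal.rpow_one]
      exact lintegral_mono fun y => mul_le_mul_right (h₂p y) _
    have e3 : ∫⁻ y, expKernel δ (x - y) * F y =
        (∫⁻ y, expKernel δ (x - y) * (B * h y ^ p y + expKernel δ y)) +
          ∫⁻ y, expKernel δ (x - y) * h y ^ p y := by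
      have m : AEMeasurable fun y => expKernel δ (x - y) * h y ^ p y :=
        (hkm x).aemeasurable.mul hhp
      rw [← lintegral_add_right' _ m]
      exact lintegral_congr fun y => mul_add _ _ _
    have one_le : (1 : ℝ≥0∞) ≤ (1 + W) ^ Q := ENNReal.one_le_rpow le_self_add
      (zero_lt_one.trans_le ((hp1 0).trans (hQ 0)))
    rw [e0, e3, hD, mul_assoc]
    refine (ENNReal.rpow_add_le_mul_rpow_add_rpow _ _ (hp1 x)).trans (mul_le_mul'
      (ENNReal.rpow_le_rpow_of_exponent_le (by norm_num) (by linarith [hQ x])) ?_)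
    refine (add_le_add e1 (e2.trans (le_mul_of_one_le_left zero_le one_le))).trans_eq ?_
    ring
  calc ∫⁻ x, (∫⁻ y, expKernel δ (x - y) * h y) ^ p x
      ≤ ∫⁻ x, D * ((∫⁻ y, expKernel δ (x - y) * F y) + 2 * W * expKernel δ x) := lintegral_mono key
    _ = D * (W * ((B * ∫⁻ y, h y ^ p y) + W + ∫⁻ y, h y ^ p y) + 2 * W * W) := by
        rw [lintegral_const_mul' _ _ hDtop,
          lintegral_add_right _ ((measurable_expKernel δ).const_mul _),
          lintegral_lintegral_expKernel_mul δ mF, lintegral_const_mul _ (measurable_expKernel δ),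
          ← hW, hF, lintegral_add_right' _ hhp, lintegral_add_right _ (measurable_expKernel δ),
          lintegral_const_mul'' _ hhp]
    _ ≤ D * (W * (B + W + 1) + 2 * W * W) := by
        gcongr
        exact mul_le_of_le_one_right zero_le hmod

/-! ### Variable exponents in logarithmic coordinates -/

theorem ae_multMeasure_pos : ∀ᵐ t ∂multMeasure, 0 < t :=
  (withDensity_absolutelyContinuous _ _).ae_le (ae_restrict_mem measurableSet_Ioi)

theorem IsVariableExponent.aemeasurable_comp_exp {q : ℝ → ℝ} (hq : IsVariableExponent q) :
    AEMeasurable fun x => q (Real.exp x) :=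
  aemeasurable_multMeasure_iff.1 (hq.1.mono_ac
    ((withDensity_absolutelyContinuous _ _).trans Measure.absolutelyContinuous_restrict))

theorem LogHolderAtInfinity.exists_le {q : ℝ → ℝ} (h : LogHolderAtInfinity q) :
    ∃ Q, ∀ x, q x ≤ Q := by
  obtain ⟨qInf, c, hc, h⟩ := h
  refine ⟨qInf + c, fun x => ?_⟩
  have h1 : 1 ≤ Real.log (Real.exp 1 + |x|) := by
    rw [Real.le_log_iff_exp_le (by positivity)]
    linarith [abs_nonneg x]
  have := (le_abs_self _).trans ((h x).trans (div_le_self hc.le h1))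
  linarith

/-- In the variable `x = log t`, log-Hölder continuity at `0` and at `∞` says that `q` tends to
`q 0` and to `qInf` at the rate `1 / |x|`. -/
theorem exists_abs_sub_mul_min_le {q : ℝ → ℝ} (h0 : LogHolderAtOrigin q)
    (hInf : LogHolderAtInfinity q) :
    ∃ c, ∀ x y : ℝ, 0 ≤ x * y → |q (Real.exp x) - q (Real.exp y)| * min |x| |y| ≤ c := by
  obtain ⟨c₀, hc₀, h0⟩ := h0
  obtain ⟨qInf, c₁, hc₁, hInf⟩ := hInf
  have key : ∀ {A c L z : ℝ}, 0 < c → 0 ≤ z → z ≤ L → 0 < L → A ≤ c / L → A * z ≤ c := by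
    intro A c L z hc hz hzL hL hA
    calc A * z ≤ c / L * z := mul_le_mul_of_nonneg_right hA hz
      _ ≤ c / L * L := mul_le_mul_of_nonneg_left hzL (by positivity)
      _ = c := div_mul_cancel₀ _ hL.ne'
  have l0 : ∀ x ≤ 0, |q (Real.exp x) - q 0| * |x| ≤ c₀ := fun x hx => by
    have hx' : |x| ≤ Real.log (Real.exp 1 + 1 / |Real.exp x|) := by
      rw [Real.le_log_iff_exp_le (by positivity), abs_of_nonpos hx, abs_of_pos (Real.exp_pos x),
        one_div, ← Real.exp_neg]
      linarith [Real.exp_pos 1]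
    refine key hc₀ (abs_nonneg x) hx' (Real.log_pos ?_) (h0 _)
    have : 0 < 1 / |Real.exp x| := by positivity
    linarith [Real.add_one_le_exp 1]
  have l1 : ∀ x ≥ 0, |q (Real.exp x) - qInf| * |x| ≤ c₁ := fun x hx => by
    have hx' : |x| ≤ Real.log (Real.exp 1 + |Real.exp x|) := by
      rw [Real.le_log_iff_exp_le (by positivity), abs_of_nonneg hx, abs_of_pos (Real.exp_pos x)]
      linarith [Real.exp_pos 1]
    refine key hc₁ (abs_nonneg x) hx' (Real.log_pos ?_) (hInf _)
    linarith [Real.add_one_le_exp 1, abs_nonneg (Real.exp x)]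
  have tri : ∀ {a b d m n c : ℝ}, 0 ≤ m → 0 ≤ n → |a - d| * m ≤ c → |b - d| * n ≤ c →
      |a - b| * min m n ≤ 2 * c := by
    intro a b d m n c hm hn h1 h2
    have hmn : 0 ≤ min m n := le_min hm hn
    have h3 : |a - b| ≤ |a - d| + |b - d| := by
      rw [abs_sub_comm b d]; exact abs_sub_le a d b
    have h4 := mul_le_mul_of_nonneg_left (min_le_left m n) (abs_nonneg (a - d))
    have h5 := mul_le_mul_of_nonneg_left (min_le_right m n) (abs_nonneg (b - d))
    have h6 := mul_le_mul_of_nonneg_right h3 hmn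
    linarith
  refine ⟨max (2 * c₀) (2 * c₁), fun x y hxy => ?_⟩
  rcases mul_nonneg_iff.1 hxy with ⟨hx, hy⟩ | ⟨hx, hy⟩
  · exact (tri (abs_nonneg x) (abs_nonneg y) (l1 x hx) (l1 y hy)).trans (le_max_right _ _)
  · exact (tri (abs_nonneg x) (abs_nonneg y) (l0 x hx) (l0 y hy)).trans (le_max_left _ _)

/-! ### Comparison of Luxemburg norms -/

theorem varNorm_le_ofReal {q g : ℝ → ℝ} {r : ℝ} (hr : 0 < r)
    (h : varModular q (fun t => g t / r) ≤ 1) : varNorm q g ≤ ENNReal.ofReal r :=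
  iInf_le_of_le r (iInf_le_of_le hr (iInf_le_of_le h le_rfl))

theorem le_mul_varNorm {q g : ℝ → ℝ} {N : ℝ≥0} (hN : N ≠ 0) {a : ℝ≥0∞}
    (h : ∀ r : ℝ, 0 < r → varModular q (fun t => g t / r) ≤ 1 → a ≤ ENNReal.ofReal (N * r)) :
    a ≤ N * varNorm q g := by
  have h0 : (N : ℝ≥0∞) ≠ 0 := ENNReal.coe_ne_zero.2 hN
  rw [varNorm, ENNReal.mul_iInf_of_ne h0 ENNReal.coe_ne_top]
  refine le_iInf fun r => ?_
  rw [ENNReal.mul_iInf_of_ne h0 ENNReal.coe_ne_top]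
  refine le_iInf fun hr => ?_
  rw [ENNReal.mul_iInf_of_ne h0 ENNReal.coe_ne_top]
  refine le_iInf fun hm => (h r hr hm).trans_eq ?_
  rw [ENNReal.ofReal_mul N.coe_nonneg]
  simp

/-- As the exponent is at least `1`, a bound for the modular gives one for the norm. -/
theorem varModular_div_le_one {q g : ℝ → ℝ} (hq : ∀ x, 1 ≤ q x) {N : ℝ≥0} (hN : 1 ≤ N)
    (h : varModular q g ≤ N) : varModular q (fun t => g t / N) ≤ 1 := by
  have hN0 : (N : ℝ≥0∞) ≠ 0 := ENNReal.coe_ne_zero.2 (zero_lt_one.trans_le hN).ne'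
  have hNr : (1 : ℝ) ≤ N := hN
  calc varModular q (fun t => g t / N)
      ≤ ∫⁻ t, (N : ℝ≥0∞)⁻¹ * ENNReal.ofReal (|g t| ^ q t) ∂multMeasure := by
        refine lintegral_mono fun t => ?_
        have e : (N : ℝ≥0∞)⁻¹ = ENNReal.ofReal ((N : ℝ)⁻¹) := by
          rw [ENNReal.ofReal_inv_of_pos (by linarith)]; simp
        rw [e, ← ENNReal.ofReal_mul (by positivity)]
        refine ENNReal.ofReal_le_ofReal ?_
        rw [abs_div, abs_of_nonneg N.coe_nonneg, div_eq_inv_mul,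
          Real.mul_rpow (by positivity) (abs_nonneg _)]
        refine mul_le_mul_of_nonneg_right ?_ (by positivity)
        simpa using Real.rpow_le_rpow_of_exponent_ge (inv_pos.2 (by linarith))
          (inv_le_one_of_one_le₀ hNr) (hq t)
    _ = (N : ℝ≥0∞)⁻¹ * varModular q g := by
        rw [lintegral_const_mul' _ _ (ENNReal.inv_ne_top.2 hN0), varModular]
    _ ≤ (N : ℝ≥0∞)⁻¹ * N := mul_le_mul_right h _
    _ = 1 := ENNReal.inv_mul_cancel hN0 ENNReal.coe_ne_top

/-! ### The two summands inside `A₀ + A₁` -/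

namespace CompatibleCouple

section

variable {𝕜 A₀ A₁ Z : Type*} [RCLike 𝕜]
  [NormedAddCommGroup A₀] [NormedSpace 𝕜 A₀] [NormedAddCommGroup A₁] [NormedSpace 𝕜 A₁]
  [AddCommGroup Z] [Module 𝕜 Z] [TopologicalSpace Z]

/-- The inclusion of `A₀` in `A₀ + A₁`. -/
def toSum₀ (C : CompatibleCouple 𝕜 A₀ A₁ Z) : A₀ →+ C.SumSpace where
  toFun a := (⟨C.incl₀ a, Submodule.mem_sup_left ⟨a, rfl⟩⟩ : C.sumSubmodule)
  map_zero' := Subtype.ext (map_zero C.incl₀)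
  map_add' a b := Subtype.ext (map_add C.incl₀ a b)

/-- The inclusion of `A₁` in `A₀ + A₁`. -/
def toSum₁ (C : CompatibleCouple 𝕜 A₀ A₁ Z) : A₁ →+ C.SumSpace where
  toFun a := (⟨C.incl₁ a, Submodule.mem_sup_right ⟨a, rfl⟩⟩ : C.sumSubmodule)
  map_zero' := Subtype.ext (map_zero C.incl₁)
  map_add' a b := Subtype.ext (map_add C.incl₁ a b)

theorem toSum₀_add_toSum₁_eq_iff (C : CompatibleCouple 𝕜 A₀ A₁ Z) {a : A₀} {b : A₁}
    {f : C.SumSpace} : C.toSum₀ a + C.toSum₁ b = f ↔ C.incl₀ a + C.incl₁ b = f.val :=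
  Subtype.ext_iff

theorem kFunctional_toSum_add_le (C : CompatibleCouple 𝕜 A₀ A₁ Z) {t : ℝ} (ht : 0 ≤ t)
    (a : A₀) (b : A₁) : C.kFunctional t (C.toSum₀ a + C.toSum₁ b) ≤ ‖a‖ + t * ‖b‖ :=
  C.kFunctional_le ht ⟨(a, b), C.toSum₀_add_toSum₁_eq_iff.1 rfl⟩

theorem interToSum_eq_toSum₁ (C : CompatibleCouple 𝕜 A₀ A₁ Z) (w : C.interSpace) :
    C.interToSum w = C.toSum₁ w.1.2 := Subtype.ext w.2

theorem norm_toSum_add_le [ContinuousAdd Z] [T2Space Z] (C : CompatibleCouple 𝕜 A₀ A₁ Z)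
    (a : A₀) (b : A₁) : ‖C.toSum₀ a + C.toSum₁ b‖ ≤ ‖a‖ + ‖b‖ := by
  simpa [SumSpace.norm_def] using C.kFunctional_toSum_add_le zero_le_one a b

theorem norm_toSum₀_le [ContinuousAdd Z] [T2Space Z] (C : CompatibleCouple 𝕜 A₀ A₁ Z)
    (a : A₀) : ‖C.toSum₀ a‖ ≤ ‖a‖ := by
  simpa using C.norm_toSum_add_le a 0

theorem norm_toSum₁_le [ContinuousAdd Z] [T2Space Z] (C : CompatibleCouple 𝕜 A₀ A₁ Z)
    (a : A₁) : ‖C.toSum₁ a‖ ≤ ‖a‖ := by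
  simpa using C.norm_toSum_add_le 0 a

theorem continuous_toSum₀ [ContinuousAdd Z] [T2Space Z] (C : CompatibleCouple 𝕜 A₀ A₁ Z) :
    Continuous C.toSum₀ :=
  AddMonoidHomClass.continuous_of_bound C.toSum₀ 1 fun a => by simpa using C.norm_toSum₀_le a

theorem continuous_toSum₁ [ContinuousAdd Z] [T2Space Z] (C : CompatibleCouple 𝕜 A₀ A₁ Z) :
    Continuous C.toSum₁ :=
  AddMonoidHomClass.continuous_of_bound C.toSum₁ 1 fun a => by simpa using C.norm_toSum₁_le a

theorem jFunctional_nonneg (C : CompatibleCouple 𝕜 A₀ A₁ Z) (t : ℝ) (w : C.interSpace) :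
    0 ≤ C.jFunctional t w := (norm_nonneg _).trans (le_max_left _ _)

theorem norm_interToSum_le [ContinuousAdd Z] [T2Space Z] (C : CompatibleCouple 𝕜 A₀ A₁ Z)
    {t : ℝ} (ht : 0 < t) (w : C.interSpace) :
    ‖C.interToSum w‖ ≤ min 1 t⁻¹ * C.jFunctional t w := by
  have h0 : ‖C.interToSum w‖ ≤ ‖w.1.1‖ := C.norm_toSum₀_le w.1.1
  have h1 : ‖C.interToSum w‖ ≤ ‖w.1.2‖ := by
    rw [interToSum_eq_toSum₁]; exact C.norm_toSum₁_le w.1.2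
  rw [min_mul_of_nonneg _ _ (C.jFunctional_nonneg t w), one_mul]
  refine le_min (h0.trans (le_max_left _ _)) (h1.trans ?_)
  rw [← div_eq_inv_mul, le_div_iff₀ ht, mul_comm]
  exact le_max_right _ _

/-! ### Dependence of the `K`-functional on its parameter -/

theorem kFunctional_mono (C : CompatibleCouple 𝕜 A₀ A₁ Z) {s t : ℝ} (hs : 0 ≤ s) (hst : s ≤ t)
    (f : C.SumSpace) : C.kFunctional s f ≤ C.kFunctional t f :=
  le_ciInf fun p => (C.kFunctional_le hs p).trans (by gcongr)

theorem kFunctional_le_div_mul (C : CompatibleCouple 𝕜 A₀ A₁ Z) {s t : ℝ} (hs : 0 < s)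
    (hst : s ≤ t) (f : C.SumSpace) : C.kFunctional t f ≤ t / s * C.kFunctional s f := by
  have ht : 0 < t := hs.trans_le hst
  rw [kFunctional.eq_def C s f, Real.mul_iInf_of_nonneg (by positivity)]
  refine le_ciInf fun p => (C.kFunctional_le ht.le p).trans ?_
  have h1 : 1 ≤ t / s := (one_le_div hs).2 hst
  have h2 : t / s * (‖p.1.1‖ + s * ‖p.1.2‖) = t / s * ‖p.1.1‖ + t * ‖p.1.2‖ := by
    field_simp
  rw [h2]
  linarith [le_mul_of_one_le_left (norm_nonneg p.1.1) h1]

theorem eq_zero_of_kFunctional_eq_zero [ContinuousAdd Z] [T2Space Z]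
    (C : CompatibleCouple 𝕜 A₀ A₁ Z) {t : ℝ} (ht : 0 < t) {f : C.SumSpace}
    (h : C.kFunctional t f = 0) : f = 0 := by
  refine C.eq_zero_of_kFunctional f (le_antisymm ?_ (C.kFunctional_nonneg zero_le_one f))
  rcases le_total 1 t with h1 | h1
  · exact (C.kFunctional_mono zero_le_one h1 f).trans h.le
  · simpa [h] using C.kFunctional_le_div_mul ht h1 f

theorem exists_decomp_le_two_mul [ContinuousAdd Z] [T2Space Z] (C : CompatibleCouple 𝕜 A₀ A₁ Z)
    {t : ℝ} (ht : 0 < t) (f : C.SumSpace) :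
    ∃ p : C.Decomp f, ‖p.1.1‖ + t * ‖p.1.2‖ ≤ 2 * C.kFunctional t f := by
  rcases (C.kFunctional_nonneg ht.le f).eq_or_lt with h | h
  · obtain rfl := C.eq_zero_of_kFunctional_eq_zero ht h.symm
    have h0 : C.incl₀ (0 : A₀ × A₁).1 + C.incl₁ (0 : A₀ × A₁).2 = (0 : C.SumSpace).val := by
      simp only [Prod.fst_zero, Prod.snd_zero, map_zero, add_zero]; rfl
    exact ⟨⟨0, h0⟩, by simp [← h]⟩
  · obtain ⟨p, hp⟩ := C.exists_decomp_lt (show C.kFunctional t f < 2 * C.kFunctional t f by linarith)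
    exact ⟨p, hp.le⟩

/-! ### From the `J`-method to the `K`-method -/

/-- If `f = ∫ u(s) ds / s`, then `f` is the sum of the integrals of `u` over `(0, t)` and `[t, ∞)`.
The first is taken in `A₀`, the second in `A₁`. -/
theorem ofReal_kFunctional_le_lintegral [CompleteSpace A₀] [CompleteSpace A₁] [ContinuousAdd Z]
    [T2Space Z] (C : CompatibleCouple 𝕜 A₀ A₁ Z) {u : ℝ → C.interSpace} {f : C.SumSpace}
    (hu : C.IsIntegralRep u f) {t : ℝ} (ht : 0 < t) :
    ENNReal.ofReal (C.kFunctional t f) ≤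
      ∫⁻ s, ENNReal.ofReal (min 1 (t / s) * C.jFunctional s (u s)) ∂multMeasure := by
  let _ : NormedSpace ℝ A₀ := NormedSpace.restrictScalars ℝ 𝕜 A₀
  let _ : NormedSpace ℝ A₁ := NormedSpace.restrictScalars ℝ 𝕜 A₁
  obtain ⟨hum, hui, rfl⟩ := hu
  set Φ : ℝ → ℝ≥0∞ := fun s => ENNReal.ofReal (min 1 (t / s) * C.jFunctional s (u s)) with hΦ
  by_cases htop : ∫⁻ s, Φ s ∂multMeasure = ∞
  · rw [htop]; exact le_top
  have m₀ : AEStronglyMeasurable (fun s => (u s).1.1) multMeasure :=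
    (continuous_fst.comp continuous_subtype_val).comp_aestronglyMeasurable hum
  have m₁ : AEStronglyMeasurable (fun s => (u s).1.2) multMeasure :=
    (continuous_snd.comp continuous_subtype_val).comp_aestronglyMeasurable hum
  have b₀ : ∫⁻ s in Iio t, ‖(u s).1.1‖ₑ ∂multMeasure ≤ ∫⁻ s in Iio t, Φ s ∂multMeasure := by
    refine lintegral_mono_ae ?_
    filter_upwards [ae_restrict_of_ae ae_multMeasure_pos, ae_restrict_mem measurableSet_Iio]
      with s hs hst
    rw [← ofReal_norm]
    refine ENNReal.ofReal_le_ofReal ?_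
    rw [min_eq_left ((one_le_div hs).2 (le_of_lt hst)), one_mul]
    exact le_max_left _ _
  have b₁ : ENNReal.ofReal t * ∫⁻ s in (Iio t)ᶜ, ‖(u s).1.2‖ₑ ∂multMeasure ≤
      ∫⁻ s in (Iio t)ᶜ, Φ s ∂multMeasure := by
    rw [← lintegral_const_mul' _ _ ENNReal.ofReal_ne_top]
    refine lintegral_mono_ae ?_
    filter_upwards [ae_restrict_of_ae ae_multMeasure_pos,
      ae_restrict_mem measurableSet_Iio.compl] with s hs hst
    rw [← ofReal_norm, ← ENNReal.ofReal_mul ht.le]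
    refine ENNReal.ofReal_le_ofReal ?_
    rw [min_eq_right ((div_le_one hs).2 (not_lt.1 hst))]
    calc t * ‖(u s).1.2‖ = t / s * (s * ‖(u s).1.2‖) := by field_simp
      _ ≤ _ := mul_le_mul_of_nonneg_left (le_max_right _ _) (by positivity)
  have i₀ : IntegrableOn (fun s => (u s).1.1) (Iio t) multMeasure :=
    ⟨m₀.restrict, (b₀.trans (setLIntegral_le_lintegral _ _)).trans_lt (lt_top_iff_ne_top.2 htop)⟩
  have i₁ : IntegrableOn (fun s => (u s).1.2) (Iio t)ᶜ multMeasure := by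
    refine ⟨m₁.restrict, lt_top_iff_ne_top.2 fun h => htop (top_le_iff.1 ?_)⟩
    rw [h, ENNReal.mul_top (ENNReal.ofReal_pos.2 ht).ne'] at b₁
    exact b₁.trans (setLIntegral_le_lintegral _ _)
  have e : ∫ s, C.interToSum (u s) ∂multMeasure =
      C.toSum₀ (∫ s in Iio t, (u s).1.1 ∂multMeasure) +
        C.toSum₁ (∫ s in (Iio t)ᶜ, (u s).1.2 ∂multMeasure) := by
    rw [← integral_add_compl measurableSet_Iio hui]
    congr 1
    · exact (C.toSum₀.toRealLinearMap C.continuous_toSum₀).integral_comp_comm i₀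
    · simp only [interToSum_eq_toSum₁]
      exact (C.toSum₁.toRealLinearMap C.continuous_toSum₁).integral_comp_comm i₁
  rw [e]
  refine (ENNReal.ofReal_le_ofReal (C.kFunctional_toSum_add_le ht.le _ _)).trans ?_
  rw [ENNReal.ofReal_add (norm_nonneg _) (by positivity), ENNReal.ofReal_mul ht.le,
    ofReal_norm, ofReal_norm, ← lintegral_add_compl Φ measurableSet_Iio]
  exact add_le_add ((enorm_integral_le_lintegral_enorm _).trans b₀)
    ((mul_le_mul_right (enorm_integral_le_lintegral_enorm _) _).trans b₁)

theorem aemeasurable_jFunctional (C : CompatibleCouple 𝕜 A₀ A₁ Z) {u : ℝ → C.interSpace}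
    (hu : AEStronglyMeasurable u multMeasure) :
    AEMeasurable (fun t => C.jFunctional t (u t)) multMeasure := by
  have m₀ : AEStronglyMeasurable (fun s => (u s).1.1) multMeasure :=
    (continuous_fst.comp continuous_subtype_val).comp_aestronglyMeasurable hu
  have m₁ : AEStronglyMeasurable (fun s => (u s).1.2) multMeasure :=
    (continuous_snd.comp continuous_subtype_val).comp_aestronglyMeasurable hu
  exact m₀.norm.aemeasurable.max (aemeasurable_id.mul m₁.norm.aemeasurable)

end

end CompatibleCouple

/-- The kernel `min 1 (t / s)` with the weights `t ^ (-θ)` and `s ^ (-θ)` decays exponentially in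
`x - y = log t - log s`. -/
theorem rpow_mul_min_one_exp_le {θ δ : ℝ} (h0 : δ ≤ θ) (h1 : δ ≤ 1 - θ) (x y : ℝ) :
    Real.exp x ^ (-θ) * min 1 (Real.exp x / Real.exp y) ≤
      Real.exp (-(δ * |x - y|)) * Real.exp y ^ (-θ) := by
  rw [← Real.exp_mul, ← Real.exp_mul, ← Real.exp_sub, ← Real.exp_zero, ← Real.exp_monotone.map_min,
    ← Real.exp_add, ← Real.exp_add, Real.exp_le_exp]
  rcases le_total x y with h | h
  · rw [min_eq_right (by linarith), abs_of_nonpos (by linarith)]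
    nlinarith
  · rw [min_eq_left (by linarith), abs_of_nonneg (by linarith)]
    nlinarith

namespace CompatibleCouple

/-- The Hardy-type inequality behind this bound is the boundedness of convolution with
`exp (-δ |x|)`, for `δ = min θ (1 - θ)`. -/
theorem exists_kNorm_le_mul_jNorm {𝕜 A₀ A₁ Z : Type*} [RCLike 𝕜]
    [NormedAddCommGroup A₀] [NormedSpace 𝕜 A₀] [CompleteSpace A₀]
    [NormedAddCommGroup A₁] [NormedSpace 𝕜 A₁] [CompleteSpace A₁]
    [AddCommGroup Z] [Module 𝕜 Z] [TopologicalSpace Z] [ContinuousAdd Z] [T2Space Z]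
    (C : CompatibleCouple 𝕜 A₀ A₁ Z) {θ : ℝ} (hθ : θ ∈ Ioo (0 : ℝ) 1)
    {q : ℝ → ℝ} (hq : IsVariableExponent q)
    (hq0 : LogHolderAtOrigin q) (hqInf : LogHolderAtInfinity q) :
    ∃ N : ℝ≥0, 0 < N ∧ ∀ f, C.kNorm θ q f ≤ N * C.jNorm θ q f := by
  obtain ⟨Q, hQ⟩ := hqInf.exists_le
  obtain ⟨c, hc⟩ := exists_abs_sub_mul_min_le hq0 hqInf
  set δ := min θ (1 - θ) with hδ
  have hδθ : δ ≤ θ := min_le_left _ _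
  have hδθ' : δ ≤ 1 - θ := min_le_right _ _
  have hδ0 : 0 < δ := lt_min hθ.1 (by linarith [hθ.2])
  obtain ⟨M, hM⟩ := exists_lintegral_conv_expKernel_rpow_le hδ0 (hδθ.trans hθ.2.le)
    hq.aemeasurable_comp_exp (fun x => hq.2 _) (fun x => hQ _) hc
  have hN : (1 : ℝ≥0) ≤ max 1 M := le_max_left _ _
  have hN0 : (0 : ℝ≥0) < max 1 M := zero_lt_one.trans_le hN
  refine ⟨max 1 M, hN0, fun f => ?_⟩
  have hN0' : ((max 1 M : ℝ≥0) : ℝ≥0∞) ≠ 0 := ENNReal.coe_ne_zero.2 hN0.ne'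
  rw [jNorm, ENNReal.mul_iInf_of_ne hN0' ENNReal.coe_ne_top]
  refine le_iInf fun u => ?_
  rw [ENNReal.mul_iInf_of_ne hN0' ENNReal.coe_ne_top]
  refine le_iInf fun hu => le_mul_varNorm hN0.ne' fun r hr hmod => ?_
  set g : ℝ → ℝ := fun t => t ^ (-θ) * C.jFunctional t (u t) / r with hg
  have hmeas : AEMeasurable fun y => ENNReal.ofReal |g (Real.exp y)| := by
    have h1 := aemeasurable_multMeasure_iff.1 (C.aemeasurable_jFunctional hu.1)
    have h2 : Measurable fun y : ℝ => Real.exp y ^ (-θ) := by fun_prop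
    exact ((h2.aemeasurable.mul h1).div_const r).abs.ennreal_ofReal
  have hkmod : varModular q (fun t => t ^ (-θ) * C.kFunctional t f / r) ≤ (max 1 M : ℝ≥0) := by
    rw [varModular_eq_lintegral_exp hq.2] at hmod ⊢
    refine (lintegral_mono fun x => ENNReal.rpow_le_rpow ?_ (zero_le_one.trans (hq.2 _))).trans
      ((hM _ hmeas hmod).trans (ENNReal.coe_le_coe.2 (le_max_right _ _)))
    have hx0 : 0 ≤ Real.exp x ^ (-θ) / r := by positivity
    rw [abs_of_nonneg (div_nonneg (mul_nonneg (by positivity)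
      (C.kFunctional_nonneg (Real.exp_pos x).le f)) hr.le), mul_div_right_comm,
      ENNReal.ofReal_mul hx0]
    refine (mul_le_mul_right (C.ofReal_kFunctional_le_lintegral hu (Real.exp_pos x)) _).trans ?_
    rw [lintegral_multMeasure, ← lintegral_const_mul' _ _ ENNReal.ofReal_ne_top]
    refine lintegral_mono fun y => ?_
    have hJ := C.jFunctional_nonneg (Real.exp y) (u (Real.exp y))
    rw [expKernel, ← ENNReal.ofReal_mul hx0, ← ENNReal.ofReal_mul (Real.exp_pos _).le]
    refine ENNReal.ofReal_le_ofReal ?_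
    rw [abs_of_nonneg (div_nonneg (mul_nonneg (by positivity) hJ) hr.le)]
    calc Real.exp x ^ (-θ) / r * (min 1 (Real.exp x / Real.exp y) *
          C.jFunctional (Real.exp y) (u (Real.exp y)))
        = (Real.exp x ^ (-θ) * min 1 (Real.exp x / Real.exp y)) *
          (C.jFunctional (Real.exp y) (u (Real.exp y)) / r) := by ring
      _ ≤ (Real.exp (-(δ * |x - y|)) * Real.exp y ^ (-θ)) *
          (C.jFunctional (Real.exp y) (u (Real.exp y)) / r) :=
        mul_le_mul_of_nonneg_right (rpow_mul_min_one_exp_le hδθ hδθ' x y) (div_nonneg hJ hr.le)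
      _ = _ := by ring
  refine varNorm_le_ofReal (mul_pos (NNReal.coe_pos.2 hN0) hr) ?_
  convert! varModular_div_le_one hq.2 hN hkmod using 2
  ext t
  rw [div_div, mul_comm r]

end CompatibleCouple

namespace CompatibleCouple

section

variable {𝕜 A₀ A₁ Z : Type*} [RCLike 𝕜]
  [NormedAddCommGroup A₀] [NormedSpace 𝕜 A₀] [NormedAddCommGroup A₁] [NormedSpace 𝕜 A₁]
  [AddCommGroup Z] [Module 𝕜 Z] [TopologicalSpace Z]

/-! ### From the `K`-method to the `J`-method -/

/-- The difference of the `A₀`-parts of two decompositions of `f` lies in `A₀ ∩ A₁`: it equals the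
difference of their `A₁`-parts with the sign changed. -/
def decompSub (C : CompatibleCouple 𝕜 A₀ A₁ Z) {f : C.SumSpace} (p p' : C.Decomp f) :
    C.interSpace :=
  ⟨(p.1.1 - p'.1.1, p'.1.2 - p.1.2), by
    have h : C.incl₀ p.1.1 + C.incl₁ p.1.2 = C.incl₀ p'.1.1 + C.incl₁ p'.1.2 := p.2.trans p'.2.symm
    change C.incl₀ (p.1.1 - p'.1.1) = C.incl₁ (p'.1.2 - p.1.2)
    rw [map_sub, map_sub, sub_eq_sub_iff_add_eq_add, h, add_comm]⟩

theorem interToSum_decompSub (C : CompatibleCouple 𝕜 A₀ A₁ Z) {f : C.SumSpace}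
    (p p' : C.Decomp f) :
    C.interToSum (C.decompSub p p') = C.toSum₀ p.1.1 - C.toSum₀ p'.1.1 :=
  map_sub C.toSum₀ _ _

theorem jFunctional_decompSub_le (C : CompatibleCouple 𝕜 A₀ A₁ Z) {f : C.SumSpace} {t : ℝ}
    (ht : 0 ≤ t) (p p' : C.Decomp f) :
    C.jFunctional t (C.decompSub p p') ≤
      (‖p.1.1‖ + t * ‖p.1.2‖) + (‖p'.1.1‖ + t * ‖p'.1.2‖) := by
  have h0 : 0 ≤ t * ‖p.1.2‖ := by positivity
  have h1 : 0 ≤ t * ‖p'.1.2‖ := by positivity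
  refine max_le ?_ ?_
  · change ‖p.1.1 - p'.1.1‖ ≤ _
    linarith [norm_sub_le p.1.1 p'.1.1]
  · change t * ‖p'.1.2 - p.1.2‖ ≤ _
    have := mul_le_mul_of_nonneg_left (norm_sub_le p'.1.2 p.1.2) ht
    linarith [norm_nonneg p.1.1, norm_nonneg p'.1.1]

/-- The fundamental lemma of interpolation theory: if `min 1 t⁻¹ * K(t, f)` is summable along
`t = exp n`, then `f` is the sum of a series in `A₀ ∩ A₁` whose `n`-th term has `J(exp n, ·)`
controlled by `K(exp n, f)`. The terms are the differences of nearly optimal decompositions at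
neighbouring parameters. -/
theorem exists_hasSum_interToSum [CompleteSpace A₀] [CompleteSpace A₁] [ContinuousAdd Z] [T2Space Z]
    (C : CompatibleCouple 𝕜 A₀ A₁ Z) {f : C.SumSpace}
    (hf : Summable fun n : ℤ => min 1 (Real.exp n)⁻¹ * C.kFunctional (Real.exp n) f) :
    ∃ v : ℤ → C.interSpace,
      (∀ n : ℤ, C.jFunctional (Real.exp n) (v n) ≤ 8 * C.kFunctional (Real.exp n) f) ∧
      (Summable fun n => ‖C.interToSum (v n)‖) ∧ HasSum (fun n => C.interToSum (v n)) f := by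
  choose p hp using fun n : ℤ => C.exists_decomp_le_two_mul (Real.exp_pos n) f
  have hJ : ∀ n : ℤ, C.jFunctional (Real.exp n) (C.decompSub (p (n + 1)) (p n)) ≤
      8 * C.kFunctional (Real.exp n) f := fun n => by
    have hle : Real.exp n ≤ Real.exp (n + 1 : ℤ) := Real.exp_le_exp.2 (by simp)
    have hK := C.kFunctional_le_div_mul (Real.exp_pos n) hle f
    have he : Real.exp (n + 1 : ℤ) / Real.exp n = Real.exp 1 := by
      rw [← Real.exp_sub]; push_cast; congr 1; ring
    rw [he] at hK
    have h1 := mul_le_mul_of_nonneg_right hle (norm_nonneg (p (n + 1)).1.2)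
    -- The constant `8` bounds `2 * (1 + exp 1)`.
    have h2 := mul_le_mul_of_nonneg_right Real.exp_one_lt_three.le
      (C.kFunctional_nonneg (Real.exp_pos n).le f)
    have := C.jFunctional_decompSub_le (Real.exp_pos n).le (p (n + 1)) (p n)
    linarith [hp n, hp (n + 1)]
  have hsum : Summable fun n => ‖C.interToSum (C.decompSub (p (n + 1)) (p n))‖ := by
    refine Summable.of_nonneg_of_le (fun n => norm_nonneg _) (fun n => ?_) (hf.mul_left 8)
    calc ‖C.interToSum (C.decompSub (p (n + 1)) (p n))‖
        ≤ min 1 (Real.exp n)⁻¹ * C.jFunctional (Real.exp n) (C.decompSub (p (n + 1)) (p n)) :=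
          C.norm_interToSum_le (Real.exp_pos n) _
      _ ≤ min 1 (Real.exp n)⁻¹ * (8 * C.kFunctional (Real.exp n) f) :=
          mul_le_mul_of_nonneg_left (hJ n) (by positivity)
      _ = _ := by ring
  refine ⟨fun n => C.decompSub (p (n + 1)) (p n), hJ, hsum, ?_⟩
  have hS := hsum.of_norm.hasSum
  have hlim := hS.comp (Finset.tendsto_Ico_neg (R := ℤ))
  set a : ℤ → ℝ := fun n => min 1 (Real.exp n)⁻¹ * C.kFunctional (Real.exp n) f with ha
  have hpos : Tendsto (fun N : ℕ => a N) atTop (𝓝 0) :=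
    (hf.comp_injective Nat.cast_injective).tendsto_atTop_zero
  have hneg : Tendsto (fun N : ℕ => a (-N)) atTop (𝓝 0) :=
    (hf.comp_injective (neg_injective.comp Nat.cast_injective)).tendsto_atTop_zero
  have hz : Tendsto (fun N : ℕ => 2 * a (-N) + 2 * a N) atTop (𝓝 0) := by
    simpa using (hneg.const_mul 2).add (hpos.const_mul 2)
  -- By telescoping, a partial sum differs from `f` by the `A₀`-part of one decomposition
  -- and the `A₁`-part of another.
  have hlim' : Tendsto (fun N : ℕ => ∑ n ∈ Finset.Ico (-(N : ℤ)) N,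
      C.interToSum (C.decompSub (p (n + 1)) (p n))) atTop (𝓝 f) := by
    rw [tendsto_iff_norm_sub_tendsto_zero]
    refine squeeze_zero (fun N => norm_nonneg _) (fun N => ?_) hz
    have hN : (1 : ℝ) ≤ Real.exp N := Real.one_le_exp (Nat.cast_nonneg N)
    have htel : ∑ n ∈ Finset.Ico (-(N : ℤ)) N, C.interToSum (C.decompSub (p (n + 1)) (p n)) =
        C.toSum₀ (p N).1.1 - C.toSum₀ (p (-N)).1.1 := by
      simp only [interToSum_decompSub]
      have := Finset.sum_Ico_int_sub N fun n => -C.toSum₀ (p n).1.1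
      simpa only [neg_sub_neg] using this
    have hfN : f = C.toSum₀ (p N).1.1 + C.toSum₁ (p N).1.2 :=
      (C.toSum₀_add_toSum₁_eq_iff.2 (p N).2).symm
    have e : ∀ g, g = C.toSum₀ (p N).1.1 + C.toSum₁ (p N).1.2 →
        C.toSum₀ (p N).1.1 - C.toSum₀ (p (-N)).1.1 - g =
          C.toSum₀ (-(p (-N)).1.1) + C.toSum₁ (-(p N).1.2) := by
      rintro g rfl
      rw [map_neg, map_neg]
      abel
    rw [htel, e f hfN]
    refine (C.norm_toSum_add_le _ _).trans ?_
    rw [norm_neg, norm_neg]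
    refine add_le_add ?_ ?_
    · have h := hp (-N)
      have h' : a (-N) = C.kFunctional (Real.exp (-N : ℤ)) f := by
        simp only [ha]
        push_cast
        rw [← Real.exp_neg, neg_neg, min_eq_left hN, one_mul]
      rw [h']
      have : 0 ≤ Real.exp (-N : ℤ) * ‖(p (-N)).1.2‖ := by positivity
      linarith
    · have h := hp N
      have h' : a N = (Real.exp (N : ℤ))⁻¹ * C.kFunctional (Real.exp (N : ℤ)) f := by
        simp only [ha]
        push_cast
        rw [min_eq_right (inv_le_one_of_one_le₀ hN)]
      rw [h', mul_left_comm, inv_mul_eq_div, le_div_iff₀ (Real.exp_pos _)]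
      linarith [norm_nonneg (p N).1.1]
  rwa [tendsto_nhds_unique hlim hlim'] at hS

/-- A series in `A₀ ∩ A₁` that converges absolutely in `A₀ + A₁` is the integral of a step
function, constant on the intervals `[exp n, exp (n + 1))` of measure `1`. -/
theorem isIntegralRep_floor_log [CompleteSpace A₀] [CompleteSpace A₁] [ContinuousAdd Z] [T2Space Z]
    (C : CompatibleCouple 𝕜 A₀ A₁ Z) {f : C.SumSpace} {v : ℤ → C.interSpace}
    (hs : Summable fun n => ‖C.interToSum (v n)‖) (hf : HasSum (fun n => C.interToSum (v n)) f) :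
    C.IsIntegralRep (fun t => v ⌊Real.log t⌋) f := by
  have hm : Measurable fun t => ⌊Real.log t⌋ := Int.measurable_floor.comp Real.measurable_log
  have hmap : Measure.map (fun t => ⌊Real.log t⌋) multMeasure = Measure.count := by
    rw [multMeasure_eq_map_exp, Measure.map_map hm Real.measurable_exp, ← map_floor_volume]
    congr 1
    ext x
    simp
  have hw : StronglyMeasurable fun n => C.interToSum (v n) := StronglyMeasurable.of_discrete
  have hi : Integrable (fun n => C.interToSum (v n)) Measure.count := integrable_count_iff.2 hs
  refine ⟨(StronglyMeasurable.of_discrete.comp_measurable hm).aestronglyMeasurable, ?_, ?_⟩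
  · exact (integrable_map_measure hw.aestronglyMeasurable hm.aemeasurable).1 (by rwa [hmap])
  · rw [← integral_map hm.aemeasurable hw.aestronglyMeasurable, hmap, integral_countable hi]
    simpa using hf.tsum_eq

/-- The sum is comparable to `∫ min 1 t⁻¹ * K(t, f) dt / t`. This integral is finite because
`t ^ θ * min 1 t⁻¹` is both bounded and integrable, while `t ^ (-θ) * K(t, f)` is at most `1` plus
the integrand of its modular. -/
theorem summable_min_one_mul_kFunctional (C : CompatibleCouple 𝕜 A₀ A₁ Z) {θ : ℝ}
    (hθ : θ ∈ Ioo (0 : ℝ) 1) {q : ℝ → ℝ} (hq : ∀ x, 1 ≤ q x) {f : C.SumSpace} {r : ℝ} (hr : 0 < r)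
    (hmod : varModular q (fun t => t ^ (-θ) * C.kFunctional t f / r) ≤ 1) :
    Summable fun n : ℤ => min 1 (Real.exp n)⁻¹ * C.kFunctional (Real.exp n) f := by
  set a : ℤ → ℝ := fun n => min 1 (Real.exp n)⁻¹ * C.kFunctional (Real.exp n) f with ha
  have ha0 : ∀ n, 0 ≤ a n := fun n =>
    mul_nonneg (by positivity) (C.kFunctional_nonneg (Real.exp_pos _).le f)
  set δ := min θ (1 - θ) with hδ
  have hδ0 : 0 < δ := lt_min hθ.1 (by linarith [hθ.2])
  set g : ℝ → ℝ := fun x => Real.exp x ^ (-θ) * C.kFunctional (Real.exp x) f / r with hg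
  have hg0 : ∀ x, 0 ≤ g x := fun x =>
    div_nonneg (mul_nonneg (by positivity) (C.kFunctional_nonneg (Real.exp_pos x).le f)) hr.le
  rw [varModular_eq_lintegral_exp hq] at hmod
  have hle : ∀ x : ℝ, a ⌊x⌋ ≤ Real.exp 1 * r * (Real.exp (-(δ * |x|)) * g x) := fun x => by
    have h1 : Real.exp ⌊x⌋ ≤ Real.exp x := Real.exp_le_exp.2 (Int.floor_le x)
    have h2 : (Real.exp ⌊x⌋)⁻¹ ≤ Real.exp 1 * (Real.exp x)⁻¹ := by
      rw [← Real.exp_neg, ← Real.exp_neg, ← Real.exp_add, Real.exp_le_exp]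
      linarith [Int.lt_floor_add_one x]
    have h3 : min 1 (Real.exp ⌊x⌋)⁻¹ ≤ Real.exp 1 * min 1 (Real.exp x)⁻¹ := by
      rw [mul_min_of_nonneg _ _ (Real.exp_pos 1).le]
      refine min_le_min ?_ h2
      rw [mul_one]
      exact Real.one_le_exp zero_le_one
    have h4 : min 1 (Real.exp x)⁻¹ ≤ Real.exp (-(δ * |x|)) * Real.exp x ^ (-θ) := by
      have := rpow_mul_min_one_exp_le (min_le_left θ (1 - θ)) (min_le_right θ (1 - θ)) 0 x
      simpa using this
    have hK := C.kFunctional_nonneg (Real.exp_pos x).le f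
    calc a ⌊x⌋ ≤ (Real.exp 1 * min 1 (Real.exp x)⁻¹) * C.kFunctional (Real.exp x) f :=
          mul_le_mul h3 (C.kFunctional_mono (Real.exp_pos _).le h1 f)
            (C.kFunctional_nonneg (Real.exp_pos _).le f) (by positivity)
      _ ≤ (Real.exp 1 * (Real.exp (-(δ * |x|)) * Real.exp x ^ (-θ))) *
          C.kFunctional (Real.exp x) f := by gcongr
      _ = _ := by simp only [hg]; field_simp
  have hE : ∫⁻ x, expKernel δ x * ENNReal.ofReal (g x) ≠ ∞ := by
    have hpt : ∀ x, expKernel δ x * ENNReal.ofReal (g x) ≤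
        expKernel δ x + ENNReal.ofReal |g x| ^ q (Real.exp x) := fun x => by
      rw [abs_of_nonneg (hg0 x)]
      rcases le_total (ENNReal.ofReal (g x)) 1 with h | h
      · exact (mul_le_of_le_one_right zero_le h).trans le_self_add
      · refine (mul_le_of_le_one_left zero_le (expKernel_le_one hδ0.le x)).trans ?_
        refine le_trans ?_ le_add_self
        simpa using ENNReal.rpow_le_rpow_of_exponent_le h (hq (Real.exp x))
    refine ne_top_of_le_ne_top ?_ (lintegral_mono hpt)
    rw [lintegral_add_left (measurable_expKernel δ)]
    exact ENNReal.add_ne_top.2 ⟨lintegral_expKernel_ne_top hδ0,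
      ne_top_of_le_ne_top ENNReal.one_ne_top hmod⟩
  have htsum : ∑' n, ENNReal.ofReal (a n) ≠ ∞ := by
    rw [← lintegral_count, ← map_floor_volume,
      lintegral_map (measurable_of_countable _) Int.measurable_floor]
    refine ne_top_of_le_ne_top ?_ (lintegral_mono fun x =>
      (ENNReal.ofReal_le_ofReal (hle x)).trans_eq
        ((ENNReal.ofReal_mul (by positivity)).trans
          (congrArg _ (ENNReal.ofReal_mul (Real.exp_pos _).le))))
    rw [lintegral_const_mul' _ _ ENNReal.ofReal_ne_top]
    exact ENNReal.mul_ne_top ENNReal.ofReal_ne_top hE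
  refine (ENNReal.summable_toReal htsum).congr fun n => ?_
  exact ENNReal.toReal_ofReal (ha0 n)

/-- The constant is `3 * 8`: the factor `8` comes from `exists_hasSum_interToSum`, and `3` bounds
the ratio `exp 1` of the end points of the steps. -/
theorem jNorm_le_mul_kNorm [CompleteSpace A₀] [CompleteSpace A₁] [ContinuousAdd Z] [T2Space Z]
    (C : CompatibleCouple 𝕜 A₀ A₁ Z) {θ : ℝ} (hθ : θ ∈ Ioo (0 : ℝ) 1) {q : ℝ → ℝ}
    (hq : ∀ x, 1 ≤ q x) (f : C.SumSpace) : C.jNorm θ q f ≤ (24 : ℝ≥0) * C.kNorm θ q f := by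
  refine le_mul_varNorm (by norm_num) fun r hr hmod => ?_
  obtain ⟨v, hvJ, hvs, hvf⟩ :=
    C.exists_hasSum_interToSum (C.summable_min_one_mul_kFunctional hθ hq hr hmod)
  refine iInf₂_le_of_le _ (C.isIntegralRep_floor_log hvs hvf)
    (varNorm_le_ofReal (mul_pos (by norm_num) hr) (le_trans ?_ hmod))
  rw [varModular_eq_lintegral_exp hq, varModular_eq_lintegral_exp hq]
  refine lintegral_mono fun x => ENNReal.rpow_le_rpow (ENNReal.ofReal_le_ofReal ?_)
    (zero_le_one.trans (hq _))
  simp only [Real.log_exp]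
  have hK := C.kFunctional_nonneg (Real.exp_pos x).le f
  have hJ0 := C.jFunctional_nonneg (Real.exp x) (v ⌊x⌋)
  have hJ : C.jFunctional (Real.exp x) (v ⌊x⌋) ≤ 24 * C.kFunctional (Real.exp x) f := by
    have h1 : Real.exp x ≤ 3 * Real.exp ⌊x⌋ := by
      have : Real.exp x ≤ Real.exp 1 * Real.exp ⌊x⌋ := by
        rw [← Real.exp_add, Real.exp_le_exp]
        linarith [Int.lt_floor_add_one x]
      exact this.trans (mul_le_mul_of_nonneg_right Real.exp_one_lt_three.le (Real.exp_pos _).le)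
    have h2 : C.jFunctional (Real.exp x) (v ⌊x⌋) ≤
        3 * C.jFunctional (Real.exp ⌊x⌋) (v ⌊x⌋) := by
      have l := le_max_left ‖(v ⌊x⌋).1.1‖ (Real.exp ⌊x⌋ * ‖(v ⌊x⌋).1.2‖)
      have r := le_max_right ‖(v ⌊x⌋).1.1‖ (Real.exp ⌊x⌋ * ‖(v ⌊x⌋).1.2‖)
      have h3 := mul_le_mul_of_nonneg_right h1 (norm_nonneg (v ⌊x⌋).1.2)
      have h4 := norm_nonneg (v ⌊x⌋).1.1
      exact max_le (by simp only [jFunctional]; linarith) (by simp only [jFunctional]; linarith)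
    have h3 := C.kFunctional_mono (Real.exp_pos _).le (Real.exp_le_exp.2 (Int.floor_le x)) f
    linarith [hvJ ⌊x⌋]
  have hw : 0 < Real.exp x ^ (-θ) := by positivity
  rw [abs_of_nonneg (by positivity), abs_of_nonneg (by positivity)]
  calc Real.exp x ^ (-θ) * C.jFunctional (Real.exp x) (v ⌊x⌋) / ((24 : ℝ≥0) * r)
      ≤ Real.exp x ^ (-θ) * (24 * C.kFunctional (Real.exp x) f) / ((24 : ℝ≥0) * r) := by gcongr
    _ = _ := by
      push_cast
      field_simp

end

end CompatibleCouple

theorem mainTheorem1 {𝕜 A₀ A₁ Z : Type*} [RCLike 𝕜]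
    [NormedAddCommGroup A₀] [NormedSpace 𝕜 A₀] [CompleteSpace A₀]
    [NormedAddCommGroup A₁] [NormedSpace 𝕜 A₁] [CompleteSpace A₁]
    [AddCommGroup Z] [Module 𝕜 Z] [TopologicalSpace Z] [IsTopologicalAddGroup Z]
    [ContinuousSMul 𝕜 Z] [T2Space Z]
    (C : CompatibleCouple 𝕜 A₀ A₁ Z) (θ : ℝ) (hθ : θ ∈ Set.Ioo (0 : ℝ) 1)
    (q : ℝ → ℝ) (hq : IsVariableExponent q)
    (hq0 : LogHolderAtOrigin q) (hqInf : LogHolderAtInfinity q) :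
    C.jSpace θ q = C.kSpace θ q ∧
      ∃ c₁ c₂ : ℝ≥0, 0 < c₁ ∧ 0 < c₂ ∧ ∀ f ∈ C.kSpace θ q,
        c₁ * C.kNorm θ q f ≤ C.jNorm θ q f ∧ C.jNorm θ q f ≤ c₂ * C.kNorm θ q f := by
  obtain ⟨N, hN, hKJ⟩ := C.exists_kNorm_le_mul_jNorm hθ hq hq0 hqInf
  have hJK := C.jNorm_le_mul_kNorm hθ hq.2
  refine ⟨Set.ext fun f => ⟨fun hf => ?_, fun hf => ?_⟩, N⁻¹, 24, inv_pos.2 hN, by norm_num,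
    fun f _ => ⟨?_, hJK f⟩⟩
  · exact (hKJ f).trans_lt (ENNReal.mul_lt_top ENNReal.coe_lt_top hf)
  · exact (hJK f).trans_lt (ENNReal.mul_lt_top ENNReal.coe_lt_top hf)
  · rw [ENNReal.coe_inv hN.ne', mul_comm, ← div_eq_mul_inv]
    exact ENNReal.div_le_of_le_mul' (hKJ f)
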